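/- A game $G=(S_1,S_2,E,w)$ consists of a finite set of states $S=S_1\uplus S_2$ owned by player 1 and player 2, a set of edges $E\subseteq S\times S$ such that every state has an outgoing edge, and a weight function $w:E\to\mathbb Z$; its size is $\|G\|=|S|+\sum_{e\in E}\big(2b(|S|)+b(|w(e)|)+1\big)$, where $b(n)$ is the number of binary digits of $n$ (and $b(0)=0$). For a play $\pi=s_0s_1s_2\dots$ let $EL_n(\pi)=\sum_{j<n}w(s_j,s_{j+1})$ be the energy level at position $n$ and let $AE(\pi)=\limsup_{n\to\infty}\frac1n\sum_{m=1}^{n}EL_m(\pi)\in[-\infty,\infty]$ be its average energy. For $U,c\in\mathbb N$ and $t\in\mathbb Q$, player 1 wins the play $\pi$ for the objective $EG_{LU}(U,c)$ iff $0\le c+EL_n(\pi)\le U$ for all $n\ge 0$, and for the objective $AE_{LU}(U,t)$ iff $0\le EL_n(\pi)\le U$ for all $n\ge0$ and $AE(\pi)\le t$; otherwise player 2 wins the play. A strategy uses at most $k$ memory states if it is encoded by a deterministic Moore machine with at most $k$ states, which reads the sequence of visited states and chooses the next state from its memory and the current state. Theorem. Pseudo-polynomial memory is both sufficient and, in general,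 necessary for both players to win $EG_{LU}$ and $AE_{LU}$ games. Precisely: (1) For every game $G$, initial state $s_0$, upper bound $U\in\mathbb N$, initial energy $c\in\mathbb N$ and threshold $t\in\mathbb Q$, and for each of the two players: if the player has a winning strategy from $s_0$ for $EG_{LU}(U,c)$ (respectively for $AE_{LU}(U,t)$), then he has one that uses at most $(U+1)\cdot|S|+1$ memory states. (2) For each player $i\in\{1,2\}$ there are a constant $N$ and games $G_U$ ($U\in\mathbb N$) with initial states, with at most $N$ states and with $\|G_U\|\le N\cdot(b(U)+1)$, such that player $i$ has a winning strategy in $G_U$ for $EG_{LU}(U,0)$, and also for $AE_{LU}(U,U)$ (threshold $t=U$), but every finite-memory winning strategy of player $i$ for either of these objectives uses at least $U+1$ memory states. (3) Polynomial memory suffices, in the situation of (1), if $U$ is polynomial in the size of the game or encoded in unary: for every polynomial $p$ there is a polynomial $q$ such that $q(\|G\|)$ memory states suffice whenever $U\le p(\|G\|)$; and there is a polynomial $q$ such that $q(\|G\|+U)$ memory states always suffice. All of this holds as well if $\limsup$ is replaced by $\liminf$ in the definition of $AE$. -/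

import Mathlib

open Filter

/-- The two players. -/
inductive Player where
  | one
  | two

/-- A weighted turn-based game graph on the state space `S`: `owner` splits `S` into the states of
the two players, there is no deadlock, and `weight s s'` is the weight of the edge `(s, s')` (its
values on pairs that are not edges are never used). -/
structure Game (S : Type) where
  owner : S → Player
  edges : Finset (S × S)
  no_deadlock : ∀ s, ∃ s', (s, s') ∈ edges
  weight : S → S → ℤ

namespace Game

variable {S : Type} (G : Game S)

/-- Size of the game: one unit per state, and for each edge the names of its two end points in
binary together with its weight in binary (with a sign bit). -/
def size [Fintype S] : ℕ :=
  Fintype.card S +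
    ∑ e ∈ G.edges, (2 * Nat.size (Fintype.card S) + Nat.size (G.weight e.1 e.2).natAbs + 1)

/-- Infinite plays (from any state). -/
def Play : Type := {π : ℕ → S // ∀ n, (π n, π (n + 1)) ∈ G.edges}

/-- Finite sequences of states that follow the edges. -/
def IsPath (l : List S) : Prop := l.IsChain (fun s s' => (s, s') ∈ G.edges)

/-- A strategy of player `i`: `move ρ s` is the choice after the prefix `ρ · s`. It matters only if
`ρ · s` is a prefix that belongs to player `i`, and then it has to follow an edge. -/
structure Strategy (i : Player) where
  move : List S → S → S
  legal : ∀ (ρ : List S) (s : S), G.owner s = i → G.IsPath (ρ ++ [s]) → (s, move ρ s) ∈ G.edges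

variable {G} in
/-- The history before position `n`, and the state at position `n`, of the play from `s₀` in which
player 1 follows `σ` and player 2 follows `τ`. -/
def run (s₀ : S) (σ : G.Strategy .one) (τ : G.Strategy .two) : ℕ → List S × S
  | 0 => ([], s₀)
  | n + 1 =>
    let p := run s₀ σ τ n
    (p.1 ++ [p.2],
      match G.owner p.2 with
      | .one => σ.move p.1 p.2
      | .two => τ.move p.1 p.2)

variable {G} in
theorem run_spec (s₀ : S) (σ : G.Strategy .one) (τ : G.Strategy .two) (n : ℕ) :
    G.IsPath ((run s₀ σ τ n).1 ++ [(run s₀ σ τ n).2]) ∧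
      ((run s₀ σ τ n).2, (run s₀ σ τ (n + 1)).2) ∈ G.edges := by
  have step : ∀ n, G.IsPath ((run s₀ σ τ n).1 ++ [(run s₀ σ τ n).2]) →
      ((run s₀ σ τ n).2, (run s₀ σ τ (n + 1)).2) ∈ G.edges := by
    intro n h
    simp only [run]
    split
    · next ho => exact σ.legal _ _ ho h
    · next ho => exact τ.legal _ _ ho h
  have path : G.IsPath ((run s₀ σ τ n).1 ++ [(run s₀ σ τ n).2]) := by
    induction n with
    | zero => simp [run, IsPath]
    | succ n ih =>
      have hs := step n ih
      have h1 : (run s₀ σ τ (n + 1)).1 = (run s₀ σ τ n).1 ++ [(run s₀ σ τ n).2] := rfl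
      rw [h1]
      unfold IsPath at ih ⊢
      rw [List.isChain_append]
      refine ⟨ih, by simp, ?_⟩
      intro x hx y hy
      simp at hx hy
      subst hx hy
      exact hs
  exact ⟨path, step n path⟩

variable {G} in
/-- The outcome of two strategies from `s₀`. -/
def outcome (s₀ : S) (σ : G.Strategy .one) (τ : G.Strategy .two) : G.Play :=
  ⟨fun n => (run s₀ σ τ n).2, fun n => (run_spec s₀ σ τ n).2⟩

variable {G} in
/-- A strategy of player `i` is winning from `s₀`, where `W` is the set of plays won by player 1
(the game is zero-sum). -/
def Winning (W : Set G.Play) (s₀ : S) : (i : Player) → G.Strategy i → Prop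
  | .one, σ => ∀ τ : G.Strategy .two, outcome s₀ σ τ ∈ W
  | .two, τ => ∀ σ : G.Strategy .one, outcome s₀ σ τ ∉ W

/-- A deterministic Moore machine for player `i` with memory set `M`. -/
structure MooreMachine (i : Player) (M : Type) where
  init : M
  update : M → S → M
  next : M → {s : S // G.owner s = i} → S

variable {G} in
/-- The machine encodes the strategy: after the prefix `ρ · s` the strategy plays `next m s`, where
`m` is the initial memory updated along `ρ`. -/
def MooreMachine.Encodes {i : Player} {M : Type} (A : G.MooreMachine i M)
    (σ : G.Strategy i) : Prop :=
  ∀ (ρ : List S) (s : S) (hs : G.owner s = i), G.IsPath (ρ ++ [s]) →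
    σ.move ρ s = A.next (ρ.foldl A.update A.init) ⟨s, hs⟩

/-- Player `i` has a winning strategy from `s₀`. -/
def Wins (i : Player) (s₀ : S) (W : Set G.Play) : Prop :=
  ∃ σ : G.Strategy i, Winning W s₀ i σ

/-- Player `i` has a winning strategy from `s₀` that is encoded by a Moore machine with at most
`k` memory states. -/
def WinsWithMemory (i : Player) (s₀ : S) (W : Set G.Play) (k : ℕ) : Prop :=
  ∃ σ : G.Strategy i, Winning W s₀ i σ ∧
    ∃ (M : Type) (_ : Fintype M) (A : G.MooreMachine i M), Fintype.card M ≤ k ∧ A.Encodes σ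

variable {G} in
/-- Energy level of a play at position `n`. -/
def energy (π : G.Play) (n : ℕ) : ℤ :=
  ∑ j ∈ Finset.range n, G.weight (π.1 j) (π.1 (j + 1))

variable {G} in
/-- Average energy of the prefix of length `n`. -/
noncomputable def averageEnergy (π : G.Play) (n : ℕ) : ℝ :=
  (1 / (n : ℝ)) * ∑ m ∈ Finset.Icc 1 n, (energy π m : ℝ)

end Game

/-- The two variants of the average-energy payoff. -/
inductive AEVariant where
  | limsup
  | liminf

namespace Game

variable {S : Type} (G : Game S)

variable {G} in
/-- The average-energy payoff of a play, in the extended reals. -/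
noncomputable def avgEnergyPayoff (π : G.Play) : AEVariant → EReal
  | .limsup => Filter.limsup (fun n : ℕ => (averageEnergy π n : EReal)) atTop
  | .liminf => Filter.liminf (fun n : ℕ => (averageEnergy π n : EReal)) atTop

/-- The lower- and upper-bounded energy objective with upper bound `U` and initial energy `c`. -/
def objEGLU (U c : ℕ) : Set G.Play :=
  {π | ∀ n, 0 ≤ (c : ℤ) + energy π n ∧ (c : ℤ) + energy π n ≤ U}

/-- The average-energy objective with threshold `t`. -/
def objAE (v : AEVariant) (t : ℚ) : Set G.Play :=
  {π | avgEnergyPayoff π v ≤ ((t : ℝ) : EReal)}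

/-- The average-energy objective under lower- and upper-bounded energy, with initial energy `0`. -/
def objAELU (v : AEVariant) (U : ℕ) (t : ℚ) : Set G.Play :=
  G.objEGLU U 0 ∩ G.objAE v t

/-- With upper bound `U`, in all EGLU games (any initial energy) and all AELU games (any threshold,
both variants) on `G` from `s₀`, each player who can win can do so with `k` memory states. -/
def MemorySuffices (s₀ : S) (U k : ℕ) : Prop :=
  ∀ i : Player,
    (∀ c : ℕ, G.Wins i s₀ (G.objEGLU U c) → G.WinsWithMemory i s₀ (G.objEGLU U c) k) ∧
    (∀ (v : AEVariant) (t : ℚ),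
      G.Wins i s₀ (G.objAELU v U t) → G.WinsWithMemory i s₀ (G.objAELU v U t) k)

variable {G} in
/-- Player `i` can win from `s₀`, but not with fewer than `k` memory states. -/
def WinsNeedingMemory (i : Player) (s₀ : S) (W : Set G.Play) (k : ℕ) : Prop :=
  G.Wins i s₀ W ∧ ∀ l : ℕ, G.WinsWithMemory i s₀ W l → k ≤ l

end Game

/-!
Sufficiency rests on positional determinacy of finite mean-payoff games. The energy level has to
stay in `0, …, U`, so the game is played on finitely many configurations (a state and an energy
level or "out of range"), and the average energy is the mean payoff for a cost that depends only on
the configuration. `Game.exists_winsWithMemory` treats the two objectives together: for `EG_LU` the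
cost of the levels in range is `0`, for `AE_LU` it is the integer multiple `Game.excess` of the
excess over the threshold, and being out of range costs `1` forever. A Moore machine that remembers
the last configuration, or that the play has not begun, then implements a positional strategy.

Positional determinacy, `exists_positional_dichotomy`, comes from discounting with a fixed factor
`1 - κ` close to `1`. The discounted total payoff `φ` is a fixed point of a contraction, and an
optimal edge from `x` to `y` satisfies `w x = φ x - φ y + κ * φ y`. Since `κ * φ` takes few values
and hardly changes along an optimal edge, there is a small threshold `θ > 0` that the play cannot
cross against a player who follows the optimal choice. Above it player 2 secures a mean payoff of
at least `θ`. Below it the weights are at most `φ x - φ y + θ`; because they are integers, `φ` can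
be rounded to an integer potential which removes the error `θ` (`exists_int_potential`), and player
1 secures partial sums that are bounded above. The conclusions are so far apart that they decide
the `limsup` and the `liminf` variant at the same time.

For necessity, `Game.oneGame` and `Game.twoGame` force the respective player to repeat a cycle
exactly `U` times before leaving it, and a machine needs `U + 1` memory states to count this. For
the threshold `U` the condition on the average energy is void (`Game.objAELU_self`).
-/

/-! ### Positional strategies in finite mean-payoff games -/

section MeanPayoff

variable {V : Type} [Fintype V]

theorem exists_le_card_forall_ne (g : V → ℤ) : ∃ c : ℕ, c ≤ Fintype.card V ∧ ∀ x, g x ≠ c := by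
  classical
  have h : (Finset.univ.image g).card < (Finset.Icc (0 : ℤ) (Fintype.card V)).card := by
    refine lt_of_le_of_lt Finset.card_image_le ?_
    simp
  obtain ⟨z, hz, hz'⟩ := Finset.exists_mem_notMem_of_card_lt_card h
  rw [Finset.mem_Icc] at hz
  refine ⟨z.toNat, by omega, fun x hx => hz' ?_⟩
  rw [Finset.mem_image]
  exact ⟨x, Finset.mem_univ _, by omega⟩

/-- A real potential that bounds integer weights up to an error `1 / (|V| + 1)` can be rounded to
an integer potential that bounds them without error: after a shift by a suitable multiple of
`1 / (|V| + 1)`, no value of the potential is so close below an integer that the error matters. -/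
theorem exists_int_potential (φ : V → ℝ) : ∃ ψ : V → ℤ, ∀ (x y : V) (k : ℤ),
    (k : ℝ) ≤ φ x - φ y + 1 / ((Fintype.card V : ℝ) + 1) → k ≤ ψ x - ψ y := by
  set N : ℤ := Fintype.card V + 1 with hN
  have hN0 : 0 < N := by omega
  obtain ⟨c, hc, hne⟩ := exists_le_card_forall_ne (fun x => (-1 - ⌊(N : ℝ) * φ x⌋) % N)
  refine ⟨fun x => (⌊(N : ℝ) * φ x⌋ + c) / N, fun x y k hk => ?_⟩
  have hNr : ((Fintype.card V : ℝ) + 1) = (N : ℝ) := by rw [hN]; push_cast; ring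
  have hNpos : (0 : ℝ) < N := by exact_mod_cast hN0
  rw [hNr] at hk
  have h1 : (N : ℝ) * φ y ≤ N * φ x - N * k + 1 := by
    have := mul_le_mul_of_nonneg_left hk hNpos.le
    have h2 : (N : ℝ) * (φ x - φ y + 1 / N) = N * φ x - N * φ y + 1 := by
      field_simp
    linarith
  have h2 : ⌊(N : ℝ) * φ y⌋ ≤ ⌊(N : ℝ) * φ x⌋ - N * k + 1 := by
    have h3 : (⌊(N : ℝ) * φ y⌋ : ℝ) ≤ N * φ y := Int.floor_le _
    have h4 : (N : ℝ) * φ x < ⌊(N : ℝ) * φ x⌋ + 1 := Int.lt_floor_add_one _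
    have h5 : ⌊(N : ℝ) * φ y⌋ ≤ ⌊(N : ℝ) * φ x - N * k + 1⌋ := by
      gcongr
    have h6 : (N : ℝ) * φ x - N * k + 1 = N * φ x + ((- (N * k) + 1 : ℤ) : ℝ) := by
      push_cast; ring
    rw [h6, Int.floor_add_intCast] at h5
    linarith
  have hx := hne x
  change k ≤ (⌊(N : ℝ) * φ x⌋ + c) / N - (⌊(N : ℝ) * φ y⌋ + c) / N
  generalize ⌊(N : ℝ) * φ x⌋ = a at *
  generalize ⌊(N : ℝ) * φ y⌋ = b at *
  have hmod : (a + c) % N ≠ N - 1 := by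
    intro h
    apply hx
    have e1 := Int.mul_ediv_add_emod (a + c) N
    rw [h] at e1
    have e2 : -1 - a = c + N * (-((a + c) / N) - 1) := by linarith
    rw [e2, Int.add_mul_emod_self_left]
    exact Int.emod_eq_of_lt (by omega) (by omega)
  have e1 := Int.mul_ediv_add_emod (a + c) N
  have e2 := Int.emod_lt_of_pos (a + c) hN0
  have e3 : (b + c) / N < (a + c) / N - k + 1 := by
    apply Int.ediv_lt_of_lt_mul hN0
    have : (a + c) % N ≤ N - 2 := by omega
    nlinarith
  omega

variable {E : V → V → Prop}

open Classical in
/-- The value of `f` that the owner of `x` gets by moving along an edge: player 1 minimizes and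
player 2 maximizes. -/
noncomputable def optSucc (own : V → Player) (hE : ∀ x, ∃ y, E x y) (f : V → ℝ) (x : V) : ℝ :=
  match own x with
  | .one => (Finset.univ.filter (E x)).inf' (by simpa [Finset.filter_nonempty_iff] using hE x) f
  | .two => (Finset.univ.filter (E x)).sup' (by simpa [Finset.filter_nonempty_iff] using hE x) f

theorem optSucc_attained (own : V → Player) (hE : ∀ x, ∃ y, E x y) (f : V → ℝ) (x : V) :
    ∃ y, E x y ∧ optSucc own hE f x = f y := by
  classical
  unfold optSucc
  split
  · obtain ⟨y, hy, h⟩ := Finset.exists_mem_eq_inf'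
      (s := Finset.univ.filter (E x)) (by simpa [Finset.filter_nonempty_iff] using hE x) f
    exact ⟨y, by simpa using hy, h⟩
  · obtain ⟨y, hy, h⟩ := Finset.exists_mem_eq_sup'
      (s := Finset.univ.filter (E x)) (by simpa [Finset.filter_nonempty_iff] using hE x) f
    exact ⟨y, by simpa using hy, h⟩

theorem optSucc_le (own : V → Player) (hE : ∀ x, ∃ y, E x y) (f : V → ℝ) {x y : V}
    (hx : own x = .one) (h : E x y) : optSucc own hE f x ≤ f y := by
  unfold optSucc
  rw [hx]
  exact Finset.inf'_le _ (by simpa using h)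

theorem le_optSucc (own : V → Player) (hE : ∀ x, ∃ y, E x y) (f : V → ℝ) {x y : V}
    (hx : own x = .two) (h : E x y) : f y ≤ optSucc own hE f x := by
  unfold optSucc
  rw [hx]
  exact Finset.le_sup' f (by simpa using h)

/-- One half of the fact that the operator is nonexpansive for the supremum norm. -/
theorem optSucc_le_add (own : V → Player) (hE : ∀ x, ∃ y, E x y) {f g : V → ℝ} {d : ℝ}
    (h : ∀ y, f y ≤ g y + d) (x : V) : optSucc own hE f x ≤ optSucc own hE g x + d := by
  cases hx : own x with
  | one =>
    obtain ⟨y, hy, e⟩ := optSucc_attained own hE g x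
    rw [e]
    exact (optSucc_le own hE f hx hy).trans (h y)
  | two =>
    obtain ⟨y, hy, e⟩ := optSucc_attained own hE f x
    rw [e]
    exact (h y).trans (add_le_add_left (le_optSucc own hE g hx hy) d)

/-- The values of the game with total payoff discounted by the factor `1 - κ`. -/
theorem exists_discounted_value (own : V → Player) (hE : ∀ x, ∃ y, E x y) (w : V → ℝ) {κ : ℝ}
    (h0 : 0 < κ) (h1 : κ < 1) :
    ∃ φ : V → ℝ, ∀ x, φ x = w x + (1 - κ) * optSucc own hE φ x := by
  let T : (V → ℝ) → (V → ℝ) := fun f x => w x + (1 - κ) * optSucc own hE f x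
  have hT : ContractingWith (Real.toNNReal (1 - κ)) T := by
    refine ⟨by rw [Real.toNNReal_lt_one]; linarith, LipschitzWith.of_dist_le_mul fun f g => ?_⟩
    rw [Real.coe_toNNReal _ (by linarith)]
    refine (dist_pi_le_iff (mul_nonneg (by linarith) dist_nonneg)).2 fun x => ?_
    have hfg : ∀ y, |f y - g y| ≤ dist f g := fun y => by
      rw [← Real.dist_eq]; exact dist_le_pi_dist f g y
    have a := optSucc_le_add own hE (f := f) (g := g) (d := dist f g)
      (fun y => by linarith [(abs_le.1 (hfg y)).2]) x
    have b := optSucc_le_add own hE (f := g) (g := f) (d := dist f g)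
      (fun y => by linarith [(abs_le.1 (hfg y)).1]) x
    have e : T f x - T g x = (1 - κ) * (optSucc own hE f x - optSucc own hE g x) := by
      simp only [T]; ring
    rw [Real.dist_eq, e, abs_mul, abs_of_pos (by linarith : (0 : ℝ) < 1 - κ)]
    exact mul_le_mul_of_nonneg_left (abs_le.2 ⟨by linarith, by linarith⟩) (by linarith)
  exact ⟨ContractingWith.fixedPoint T hT, fun x => (congrFun hT.fixedPoint_isFixedPt x).symm⟩

/-- Positional determinacy of finite mean-payoff games with weights on the vertices, witnessed by
potentials. One positional choice `σ` serves both players. From `R`, a play in which player 1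
follows `σ` stays in `R`, and its partial sums are bounded above; from outside `R`, a play in which
player 2 follows `σ` stays outside, and its partial sums grow at least linearly. -/
theorem exists_positional_dichotomy (own : V → Player) (hE : ∀ x, ∃ y, E x y) (w : V → ℤ) :
    ∃ (R : Set V) (σ : V → V) (ψ : V → ℤ) (φ : V → ℝ) (ε : ℝ), 0 < ε ∧ (∀ x, E x (σ x)) ∧
      (∀ x ∈ R, ∀ y, E x y → (own x = .one → y = σ x) → y ∈ R ∧ w x ≤ ψ x - ψ y) ∧
      (∀ x ∉ R, ∀ y, E x y → (own x = .two → y = σ x) → y ∉ R ∧ φ x - φ y + ε ≤ w x) := by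
  set n : ℝ := (Fintype.card V : ℝ) + 1 with hn
  have hn0 : 1 ≤ n := by rw [hn]; linarith [Nat.cast_nonneg (α := ℝ) (Fintype.card V)]
  set W : ℝ := ‖fun x => (w x : ℝ)‖ with hW
  have hW0 : 0 ≤ W := norm_nonneg _
  have hw : ∀ x, |(w x : ℝ)| ≤ W := fun x => norm_le_pi_norm (fun x => (w x : ℝ)) x
  -- `δ` is the distance of the candidate thresholds; the discounted values of the two ends of an
  -- optimal edge differ by at most `2 * κ * W < δ`
  set δ : ℝ := 1 / n ^ 2 with hδ
  have hδ0 : 0 < δ := by positivity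
  have hδ1 : δ ≤ 1 := by
    rw [hδ, div_le_one (by positivity)]
    exact one_le_pow₀ hn0
  set κ : ℝ := δ / (2 * (W + 1)) with hκ
  have hκ0 : 0 < κ := by positivity
  have hκe : κ * (2 * (W + 1)) = δ := by rw [hκ]; field_simp
  have hκ1 : κ < 1 := by nlinarith
  have hκW : 2 * κ * W ≤ δ := by nlinarith
  obtain ⟨φ, hφ⟩ := exists_discounted_value own hE (fun x => (w x : ℝ)) hκ0 hκ1
  have hv : ∀ x, |κ * φ x| ≤ W := by
    have h : ‖φ‖ ≤ W + (1 - κ) * ‖φ‖ := by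
      refine (pi_norm_le_iff_of_nonneg (by
        have := norm_nonneg φ
        nlinarith)).2 fun x => ?_
      obtain ⟨y, -, hy⟩ := optSucc_attained own hE φ x
      rw [hφ x, hy, Real.norm_eq_abs]
      refine (abs_add_le _ _).trans (add_le_add (hw x) ?_)
      rw [abs_mul, abs_of_pos (by linarith : (0 : ℝ) < 1 - κ)]
      exact mul_le_mul_of_nonneg_left (norm_le_pi_norm φ y) (by linarith)
    intro x
    rw [abs_mul, abs_of_pos hκ0]
    have : |φ x| ≤ ‖φ‖ := norm_le_pi_norm φ x
    nlinarith
  choose σ hσE hσ using optSucc_attained own hE φ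
  obtain ⟨j, hj, hgap⟩ := exists_le_card_forall_ne (fun x => ⌈κ * φ x / δ⌉ - 2)
  set θ : ℝ := (j + 1) * δ with hθ
  have hθ0 : 0 < θ := by positivity
  have hθn : θ ≤ 1 / n := by
    have h1 : (j : ℝ) + 1 ≤ n := by
      rw [hn]
      have : (j : ℝ) ≤ Fintype.card V := by exact_mod_cast hj
      linarith
    calc θ ≤ n * δ := mul_le_mul_of_nonneg_right h1 hδ0.le
      _ = 1 / n := by rw [hδ]; field_simp
  -- no discounted value lies between the threshold `θ` and the next candidate
  have hθgap : ∀ x, κ * φ x ≤ θ + δ → κ * φ x ≤ θ := by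
    intro x hx
    by_contra hlt
    push Not at hlt
    apply hgap x
    have : ⌈κ * φ x / δ⌉ = (j : ℤ) + 2 := by
      rw [Int.ceil_eq_iff]
      constructor
      · rw [lt_div_iff₀ hδ0]; push_cast; rw [hθ] at hlt; linarith
      · rw [div_le_iff₀ hδ0]; push_cast; rw [hθ] at hx; linarith
    simp only [this]
    ring
  obtain ⟨ψ, hψ⟩ := exists_int_potential φ
  refine ⟨{x | κ * φ x ≤ θ}, σ, ψ, φ, θ, hθ0, hσE, fun x hx y hxy hy => ?_, fun x hx y hxy hy => ?_⟩
  · have h1 : φ y ≤ optSucc own hE φ x := by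
      cases ho : own x with
      | one => rw [hy ho, hσ]
      | two => exact le_optSucc own hE φ ho hxy
    have h2 : (w x : ℝ) + (1 - κ) * φ y ≤ φ x := by
      rw [hφ x]
      have := mul_le_mul_of_nonneg_left h1 (by linarith : (0 : ℝ) ≤ 1 - κ)
      linarith
    have hx' : κ * φ x ≤ θ := hx
    have h3 : κ * φ y ≤ θ := by
      apply hθgap
      have a := (abs_le.1 (hv y)).2
      have b := (abs_le.1 (hw x)).1
      have c := mul_le_mul_of_nonneg_left (by linarith : φ y ≤ φ x + 2 * W) hκ0.le
      linarith
    refine ⟨h3, hψ x y (w x) ?_⟩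
    rw [← hn]
    linarith
  · have h1 : optSucc own hE φ x ≤ φ y := by
      cases ho : own x with
      | two => rw [hy ho, hσ]
      | one => exact optSucc_le own hE φ ho hxy
    have h2 : φ x ≤ (w x : ℝ) + (1 - κ) * φ y := by
      rw [hφ x]
      have := mul_le_mul_of_nonneg_left h1 (by linarith : (0 : ℝ) ≤ 1 - κ)
      linarith
    have hx' : θ + δ < κ * φ x := by
      by_contra h
      exact hx (hθgap x (not_lt.1 h))
    have h3 : θ < κ * φ y := by
      have a := (abs_le.1 (hv y)).1
      have b := (abs_le.1 (hw x)).2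
      have c := mul_le_mul_of_nonneg_left (by linarith : φ x - 2 * W ≤ φ y) hκ0.le
      linarith
    refine ⟨not_le.2 h3, ?_⟩
    linarith

end MeanPayoff

/-! ### Moore machines that track the energy level -/

namespace Game

variable {S : Type} {G : Game S}

theorem length_run (s₀ : S) (σ : G.Strategy .one) (τ : G.Strategy .two) (n : ℕ) :
    (run s₀ σ τ n).1.length = n := by
  induction n with
  | zero => rfl
  | succ n ih => simp [run, ih]

theorem outcome_zero (s₀ : S) (σ : G.Strategy .one) (τ : G.Strategy .two) :
    (outcome s₀ σ τ).1 0 = s₀ := rfl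

theorem outcome_succ_of_one {s₀ : S} {σ : G.Strategy .one} {τ : G.Strategy .two} {n : ℕ}
    (h : G.owner ((outcome s₀ σ τ).1 n) = .one) :
    (outcome s₀ σ τ).1 (n + 1) = σ.move (run s₀ σ τ n).1 ((outcome s₀ σ τ).1 n) := by
  have h' : G.owner (run s₀ σ τ n).2 = .one := h
  simp only [outcome, run]
  rw [h']

theorem outcome_succ_of_two {s₀ : S} {σ : G.Strategy .one} {τ : G.Strategy .two} {n : ℕ}
    (h : G.owner ((outcome s₀ σ τ).1 n) = .two) :
    (outcome s₀ σ τ).1 (n + 1) = τ.move (run s₀ σ τ n).1 ((outcome s₀ σ τ).1 n) := by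
  have h' : G.owner (run s₀ σ τ n).2 = .two := h
  simp only [outcome, run]
  rw [h']

theorem energy_zero (π : G.Play) : energy π 0 = 0 := rfl

theorem energy_succ (π : G.Play) (n : ℕ) :
    energy π (n + 1) = energy π n + G.weight (π.1 n) (π.1 (n + 1)) :=
  Finset.sum_range_succ _ _

/-- The memory of a machine before it reads the state at position `n` of the play. -/
def memory {i : Player} {M : Type} (A : G.MooreMachine i M) (π : G.Play) : ℕ → M
  | 0 => A.init
  | n + 1 => A.update (memory A π n) (π.1 n)

/-- The memory in the definition of `MooreMachine.Encodes` is the memory along the outcome. -/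
theorem foldl_update_run {i : Player} {M : Type} (A : G.MooreMachine i M) (s₀ : S)
    (σ : G.Strategy .one) (τ : G.Strategy .two) (n : ℕ) :
    (run s₀ σ τ n).1.foldl A.update A.init = memory A (outcome s₀ σ τ) n := by
  induction n with
  | zero => rfl
  | succ n ih =>
    have h : (run s₀ σ τ (n + 1)).1 = (run s₀ σ τ n).1 ++ [(outcome s₀ σ τ).1 n] := rfl
    rw [h, List.foldl_append, ih]
    rfl

theorem outcome_succ_of_encodes_one {M : Type} {A : G.MooreMachine .one M} {s₀ : S}
    {σ : G.Strategy .one} (hA : A.Encodes σ) (τ : G.Strategy .two) (n : ℕ)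
    (h : G.owner ((outcome s₀ σ τ).1 n) = .one) :
    (outcome s₀ σ τ).1 (n + 1) = A.next (memory A (outcome s₀ σ τ) n) ⟨_, h⟩ := by
  rw [outcome_succ_of_one h, hA _ _ h (run_spec s₀ σ τ n).1, foldl_update_run]

theorem outcome_succ_of_encodes_two {M : Type} {A : G.MooreMachine .two M} {s₀ : S}
    {τ : G.Strategy .two} (hA : A.Encodes τ) (σ : G.Strategy .one) (n : ℕ)
    (h : G.owner ((outcome s₀ σ τ).1 n) = .two) :
    (outcome s₀ σ τ).1 (n + 1) = A.next (memory A (outcome s₀ σ τ) n) ⟨_, h⟩ := by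
  rw [outcome_succ_of_two h, hA _ _ h (run_spec s₀ σ τ n).1, foldl_update_run]

/-- A machine that always moves along edges encodes a strategy. -/
theorem exists_encodes {i : Player} {M : Type} (A : G.MooreMachine i M)
    (hA : ∀ m s, (s.1, A.next m s) ∈ G.edges) : ∃ σ : G.Strategy i, A.Encodes σ := by
  classical
  refine ⟨⟨fun ρ s => if h : G.owner s = i then A.next (ρ.foldl A.update A.init) ⟨s, h⟩ else s,
    fun ρ s h _ => ?_⟩, fun ρ s h _ => ?_⟩
  · rw [dif_pos h]
    exact hA _ ⟨s, h⟩
  · exact dif_pos h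

/-- An energy level as an element of the range `0, …, U`; `none` if it is out of range. -/
def clamp (U : ℕ) (z : ℤ) : Option (Fin (U + 1)) :=
  if h : 0 ≤ z ∧ z ≤ U then some ⟨z.toNat, by omega⟩ else none

theorem clamp_of_mem {U : ℕ} {z : ℤ} (h : 0 ≤ z ∧ z ≤ U) :
    ∃ e : Fin (U + 1), clamp U z = some e ∧ ((e : ℕ) : ℤ) = z :=
  ⟨⟨z.toNat, by omega⟩, dif_pos h, by simp [h.1]⟩

theorem mem_of_clamp_ne_none {U : ℕ} {z : ℤ} (h : clamp U z ≠ none) : 0 ≤ z ∧ z ≤ U := by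
  by_contra h'
  exact h (dif_neg h')

variable (G) in
/-- The energy component of the configuration after the move from `s` to `s'`; leaving the range
`0, …, U` is irrevocable. -/
def nextLevel (U : ℕ) (s s' : S) (l : Option (Fin (U + 1))) : Option (Fin (U + 1)) :=
  l.bind fun e => clamp U (((e : ℕ) : ℤ) + G.weight s s')

variable (G) in
/-- The edges of the graph of configurations, which are pairs of a state and an energy level. -/
def ConfigEdge (U : ℕ) (x y : S × Option (Fin (U + 1))) : Prop :=
  (x.1, y.1) ∈ G.edges ∧ y.2 = G.nextLevel U x.1 y.1 x.2

/-- Weights on the configurations: the cost `k` of the energy level, and `1` out of range. -/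
def configCost {S : Type} {U : ℕ} (k : ℤ → ℤ) (x : S × Option (Fin (U + 1))) : ℤ :=
  match x.2 with
  | none => 1
  | some e => k ((e : ℕ) : ℤ)

variable (G) in
/-- The configuration on arrival at `s`, computed from the configuration before; `none` stands for
the start of the play, with initial energy `c`. -/
def arrive (U c : ℕ) (m : Option (S × Fin (U + 1))) (s : S) : S × Option (Fin (U + 1)) :=
  match m with
  | none => (s, clamp U c)
  | some p => (s, clamp U (((p.2 : ℕ) : ℤ) + G.weight p.1 s))

theorem arrive_fst (U c : ℕ) (m : Option (S × Fin (U + 1))) (s : S) :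
    (G.arrive U c m s).1 = s := by
  cases m <;> rfl

variable (G) in
/-- The machine that remembers the last configuration and plays the positional choice `f` on
configurations. Once the energy has left the range, the play is decided and the memory is
irrelevant. -/
def trackingMachine (i : Player) (U c : ℕ)
    (f : S × Option (Fin (U + 1)) → S × Option (Fin (U + 1))) :
    G.MooreMachine i (Option (S × Fin (U + 1))) where
  init := none
  update m s := (G.arrive U c m s).2.map fun e => (s, e)
  next m s := (f (G.arrive U c m s.1)).1

/-- As long as the energy has been in range before, the machine knows the current configuration.
This includes the first position out of range. -/
theorem arrive_memory {i : Player} {U c : ℕ}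
    {f : S × Option (Fin (U + 1)) → S × Option (Fin (U + 1))} (π : G.Play) (n : ℕ)
    (h : ∀ j < n, 0 ≤ (c : ℤ) + energy π j ∧ (c : ℤ) + energy π j ≤ U) :
    G.arrive U c (memory (G.trackingMachine i U c f) π n) (π.1 n) =
      (π.1 n, clamp U (c + energy π n)) := by
  induction n with
  | zero => simp [memory, trackingMachine, arrive, energy_zero]
  | succ n ih =>
    have ih := ih fun j hj => h j (by omega)
    obtain ⟨e, he, he'⟩ := clamp_of_mem (h n (by omega))
    have : memory (G.trackingMachine i U c f) π (n + 1) = some (π.1 n, e) := by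
      change (G.arrive U c _ (π.1 n)).2.map _ = _
      rw [ih, he]
      rfl
    rw [this]
    simp only [arrive, he', energy_succ, add_assoc]

theorem configEdge_of_play {U c : ℕ} (π : G.Play) (n : ℕ)
    (h : 0 ≤ (c : ℤ) + energy π n ∧ (c : ℤ) + energy π n ≤ U) :
    G.ConfigEdge U (π.1 n, clamp U (c + energy π n))
      (π.1 (n + 1), clamp U (c + energy π (n + 1))) := by
  obtain ⟨e, he, he'⟩ := clamp_of_mem h
  refine ⟨π.2 n, ?_⟩
  simp only [nextLevel, he, Option.bind_some, he', energy_succ, add_assoc]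

theorem configCost_of_mem {U : ℕ} {k : ℤ → ℤ} {z : ℤ} (s : S) (h : 0 ≤ z ∧ z ≤ U) :
    configCost k (s, clamp U z) = k z := by
  obtain ⟨e, he, he'⟩ := clamp_of_mem h
  simp only [configCost, he, he']

theorem ConfigEdge.eq_of_fst_eq {U : ℕ} {x y z : S × Option (Fin (U + 1))}
    (hy : G.ConfigEdge U x y) (hz : G.ConfigEdge U x z) (h : y.1 = z.1) : y = z :=
  Prod.ext h (by rw [hy.2, hz.2, h])

/-- An objective that lies between two mean-payoff conditions, for the cost `k` of the energy
levels: player 1 wins if the energy stays in range and the partial sums of the costs are bounded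
above, and loses if the energy leaves the range or the partial sums grow linearly. Such a game can
be won positionally on the configurations by one of the players. -/
theorem exists_winsWithMemory [Fintype S] {W : Set G.Play} {U c : ℕ} (k : ℤ → ℤ)
    (hW₁ : ∀ π ∈ G.objEGLU U c, (∃ C : ℤ, ∀ n,
      ∑ m ∈ Finset.range n, k (c + energy π m) ≤ C) → π ∈ W)
    (hW₂ : ∀ π ∈ W, π ∈ G.objEGLU U c ∧ ¬ ∃ ε C : ℝ, 0 < ε ∧ ∀ n : ℕ,
      ε * n - C ≤ ((∑ m ∈ Finset.range n, k (c + energy π m) : ℤ) : ℝ)) (s₀ : S) :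
    ∃ i : Player, G.WinsWithMemory i s₀ W ((U + 1) * Fintype.card S + 1) := by
  have hE : ∀ x : S × Option (Fin (U + 1)), ∃ y, G.ConfigEdge U x y := fun x => by
    obtain ⟨s', hs'⟩ := G.no_deadlock x.1
    exact ⟨(s', G.nextLevel U x.1 s' x.2), hs', rfl⟩
  obtain ⟨R, f, ψ, φ, ε, hε, hf, hR, hRc⟩ :=
    exists_positional_dichotomy (fun x => G.owner x.1) hE (configCost k)
  have hcard : Fintype.card (Option (S × Fin (U + 1))) ≤ (U + 1) * Fintype.card S + 1 := by
    rw [Fintype.card_option, Fintype.card_prod, Fintype.card_fin, mul_comm]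
  have hlegal : ∀ i m s, (s.1, (G.trackingMachine i U c f).next m s) ∈ G.edges := fun i m s => by
    have h := (hf (G.arrive U c m s.1)).1
    rwa [arrive_fst] at h
  by_cases hx₀ : ((s₀, clamp U c) : S × Option (Fin (U + 1))) ∈ R
  · refine ⟨.one, ?_⟩
    obtain ⟨σ, hσ⟩ := exists_encodes _ (hlegal .one)
    refine ⟨σ, fun τ => ?_, _, inferInstance, _, hcard, hσ⟩
    set π := outcome s₀ σ τ with hπ
    -- out of range every step costs 1 and there is no return, which a potential on `R` excludes
    have hnone : ∀ x ∈ R, x.2 ≠ none := by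
      intro x hx hxn
      obtain ⟨z, ⟨hzR, hzn⟩, hmin⟩ := Set.exists_min_image {x | x ∈ R ∧ x.2 = none} ψ
        (Set.toFinite _) ⟨x, hx, hxn⟩
      obtain ⟨h1, h2⟩ := hR z hzR (f z) (hf z) fun _ => rfl
      have h3 : (f z).2 = none := by rw [(hf z).2, hzn]; rfl
      have h4 := hmin _ ⟨h1, h3⟩
      have h5 : configCost k z = 1 := by rw [configCost, hzn]
      omega
    have key : ∀ n, (∀ j ≤ n, 0 ≤ (c : ℤ) + energy π j ∧ (c : ℤ) + energy π j ≤ U) ∧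
        ((π.1 n, clamp U (c + energy π n)) : S × Option (Fin (U + 1))) ∈ R ∧
        ∑ m ∈ Finset.range n, k (c + energy π m) ≤
          ψ (s₀, clamp U c) - ψ (π.1 n, clamp U (c + energy π n)) := by
      intro n
      induction n with
      | zero =>
        have : (c : ℤ) + energy π 0 = c := by simp [energy_zero]
        refine ⟨fun j hj => ?_, ?_, ?_⟩
        · obtain rfl : j = 0 := by omega
          rw [this]
          exact mem_of_clamp_ne_none (hnone _ hx₀)
        · rw [this]
          exact hx₀
        · rw [this]
          simp [hπ, outcome_zero]
      | succ n ih =>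
        obtain ⟨h1, h2, h3⟩ := ih
        have hedge := configEdge_of_play π n (h1 n le_rfl)
        obtain ⟨h4, h5⟩ := hR _ h2 _ hedge fun ho => by
          refine hedge.eq_of_fst_eq (hf _) ?_
          refine (outcome_succ_of_encodes_one hσ τ n ho).trans ?_
          rw [← arrive_memory π n fun j hj => h1 j hj.le]
          rfl
        have hn := mem_of_clamp_ne_none (hnone _ h4)
        refine ⟨fun j hj => ?_, h4, ?_⟩
        · rcases Nat.lt_or_eq_of_le hj with hj | rfl
          · exact h1 j (by omega)
          · exact hn
        · rw [configCost_of_mem _ (h1 n le_rfl)] at h5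
          rw [Finset.sum_range_succ]
          linarith
    obtain ⟨B, hB⟩ := (Set.finite_range fun x => -ψ x).bddAbove
    refine hW₁ π (fun n => (key n).1 n le_rfl) ⟨ψ (s₀, clamp U c) + B, fun n => ?_⟩
    have := hB ⟨(π.1 n, clamp U (c + energy π n)), rfl⟩
    simp only at this
    linarith [(key n).2.2]
  · refine ⟨.two, ?_⟩
    obtain ⟨τ, hτ⟩ := exists_encodes _ (hlegal .two)
    refine ⟨τ, fun σ hπW => ?_, _, inferInstance, _, hcard, hτ⟩
    set π := outcome s₀ σ τ with hπ
    obtain ⟨hrange, hno⟩ := hW₂ _ hπW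
    have key : ∀ n, ((π.1 n, clamp U (c + energy π n)) : S × Option (Fin (U + 1))) ∉ R ∧
        φ (s₀, clamp U c) - φ (π.1 n, clamp U (c + energy π n)) + ε * n ≤
          ((∑ m ∈ Finset.range n, k (c + energy π m) : ℤ) : ℝ) := by
      intro n
      induction n with
      | zero =>
        have : (c : ℤ) + energy π 0 = c := by simp [energy_zero]
        rw [this]
        exact ⟨hx₀, by simp [hπ, outcome_zero]⟩
      | succ n ih =>
        have hedge := configEdge_of_play π n (hrange n)
        obtain ⟨h4, h5⟩ := hRc _ ih.1 _ hedge fun ho => by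
          refine hedge.eq_of_fst_eq (hf _) ?_
          refine (outcome_succ_of_encodes_two hτ σ n ho).trans ?_
          rw [← arrive_memory π n fun j _ => hrange j]
          rfl
        refine ⟨h4, ?_⟩
        rw [configCost_of_mem _ (hrange n)] at h5
        rw [Finset.sum_range_succ]
        push_cast at ih ⊢
        linarith [ih.2]
    obtain ⟨B, hB⟩ := (Set.finite_range φ).bddAbove
    refine hno ⟨ε, B - φ (s₀, clamp U c), hε, fun n => ?_⟩
    have := hB ⟨(π.1 n, clamp U (c + energy π n)), rfl⟩
    linarith [(key n).2]

/-- The players cannot both win, so a finite-memory strategy of one of them suffices for whoever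
wins. -/
theorem winsWithMemory_of_wins {W : Set G.Play} {s₀ : S} {l : ℕ}
    (h : ∃ j : Player, G.WinsWithMemory j s₀ W l) (i : Player) (hi : G.Wins i s₀ W) :
    G.WinsWithMemory i s₀ W l := by
  obtain ⟨j, hj⟩ := h
  obtain ⟨σ, hσ⟩ := hi
  cases i <;> cases j
  · exact hj
  · obtain ⟨τ, hτ, -⟩ := hj
    exact absurd (hσ τ) (hτ σ)
  · obtain ⟨τ, hτ, -⟩ := hj
    exact absurd (hτ σ) (hσ τ)
  · exact hj

/-! ### Average energy as a mean payoff -/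

/-- The cost for the threshold `t`: the excess of the energy over `t`, scaled to an integer. -/
def excess (t : ℚ) (z : ℤ) : ℤ := t.den * z - t.num

/-- The partial sums of the cost start at position `0`, where the energy is `0` and the cost is
`-t.num`; the average energy starts at position `1`. -/
theorem sum_excess (t : ℚ) (π : G.Play) (n : ℕ) :
    ((∑ m ∈ Finset.range (n + 1), excess t (((0 : ℕ) : ℤ) + energy π m) : ℤ) : ℝ) =
      t.den * (∑ m ∈ Finset.Icc 1 n, (energy π m : ℝ) - t * n) - t.num := by
  have ht : (t : ℝ) * t.den = t.num := by exact_mod_cast Rat.mul_den_eq_num t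
  induction n with
  | zero => simp [excess, energy_zero]
  | succ n ih =>
    rw [Finset.sum_range_succ, Finset.sum_Icc_succ_top (by omega)]
    push_cast [excess] at ih ⊢
    rw [ih]
    linear_combination ht

theorem tendsto_coe_add_div (a C : ℝ) :
    Tendsto (fun n : ℕ => ((a + C / n : ℝ) : EReal)) atTop (nhds (a : EReal)) := by
  refine (continuous_coe_real_ereal.tendsto a).comp ?_
  simpa using (tendsto_const_nhds (x := a)).add (tendsto_const_div_atTop_nhds_zero_nat C)

theorem avgEnergyPayoff_le {π : G.Play} {a C : ℝ}
    (h : ∀ n : ℕ, ∑ m ∈ Finset.Icc 1 n, (energy π m : ℝ) ≤ a * n + C) (v : AEVariant) :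
    avgEnergyPayoff π v ≤ (a : EReal) := by
  have key : limsup (fun n : ℕ => (averageEnergy π n : EReal)) atTop ≤ (a : EReal) := by
    rw [← (tendsto_coe_add_div a C).limsup_eq]
    refine limsup_le_limsup ?_
    filter_upwards [eventually_gt_atTop 0] with n hn
    have hn' : (0 : ℝ) < n := by exact_mod_cast hn
    rw [EReal.coe_le_coe_iff, averageEnergy, one_div, inv_mul_le_iff₀ hn', mul_add,
      mul_div_cancel₀ _ hn'.ne']
    linarith [h n]
  cases v with
  | limsup => exact key
  | liminf => exact le_trans liminf_le_limsup key

theorem le_avgEnergyPayoff {π : G.Play} {a C : ℝ}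
    (h : ∀ n : ℕ, a * n + C ≤ ∑ m ∈ Finset.Icc 1 n, (energy π m : ℝ)) (v : AEVariant) :
    (a : EReal) ≤ avgEnergyPayoff π v := by
  have key : (a : EReal) ≤ liminf (fun n : ℕ => (averageEnergy π n : EReal)) atTop := by
    rw [← (tendsto_coe_add_div a C).liminf_eq]
    refine liminf_le_liminf ?_
    filter_upwards [eventually_gt_atTop 0] with n hn
    have hn' : (0 : ℝ) < n := by exact_mod_cast hn
    rw [EReal.coe_le_coe_iff, averageEnergy, one_div, le_inv_mul_iff₀ hn', mul_add,
      mul_div_cancel₀ _ hn'.ne']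
    linarith [h n]
  cases v with
  | limsup => exact le_trans key liminf_le_limsup
  | liminf => exact key

theorem memorySuffices [Fintype S] (s₀ : S) (U : ℕ) :
    G.MemorySuffices s₀ U ((U + 1) * Fintype.card S + 1) := by
  refine fun i => ⟨fun c => winsWithMemory_of_wins ?_ i,
    fun v t => winsWithMemory_of_wins ?_ i⟩
  -- with cost `0` in range, linear growth of the partial sums is impossible
  · refine exists_winsWithMemory (c := c) (fun _ => 0) (fun π hπ _ => hπ) (fun π hπ => ⟨hπ, ?_⟩) s₀
    rintro ⟨ε, C, hε, h⟩
    obtain ⟨n, hn⟩ := exists_nat_gt (C / ε)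
    rw [div_lt_iff₀ hε] at hn
    have := h n
    simp only [Finset.sum_const_zero, Int.cast_zero] at this
    linarith
  · have hd : (0 : ℝ) < t.den := by exact_mod_cast t.den_pos
    refine exists_winsWithMemory (W := G.objAELU v U t) (c := 0) (excess t)
      (fun π hπ hC => ⟨hπ, ?_⟩) (fun π hπ => ⟨hπ.1, ?_⟩) s₀
    · obtain ⟨C, hC⟩ := hC
      refine avgEnergyPayoff_le (C := (C + t.num) / t.den) (fun n => ?_) v
      have h1 : ((∑ m ∈ Finset.range (n + 1), excess t (((0 : ℕ) : ℤ) + energy π m) : ℤ) : ℝ)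
          ≤ C := by
        exact_mod_cast hC (n + 1)
      rw [sum_excess] at h1
      rw [← sub_le_iff_le_add', le_div_iff₀ hd]
      linarith
    · rintro ⟨ε, C, hε, h⟩
      have h1 := le_avgEnergyPayoff (π := π) (a := t + ε / t.den)
        (C := (ε - C + t.num) / t.den) (fun n => by
          have := h (n + 1)
          rw [sum_excess] at this
          have e : ((t : ℝ) + ε / t.den) * n + (ε - C + t.num) / t.den =
              t * n + (ε * n + (ε - C + t.num)) / t.den := by ring
          rw [e, ← le_sub_iff_add_le', div_le_iff₀ hd]
          push_cast at this
          linarith) v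
      have h2 := h1.trans hπ.2
      rw [EReal.coe_le_coe_iff] at h2
      have : 0 < ε / t.den := by positivity
      linarith

theorem WinsWithMemory.mono {i : Player} {s₀ : S} {W : Set G.Play} {k l : ℕ} (hkl : k ≤ l)
    (h : G.WinsWithMemory i s₀ W k) : G.WinsWithMemory i s₀ W l := by
  obtain ⟨σ, hσ, M, hM, A, hA, hAσ⟩ := h
  exact ⟨σ, hσ, M, hM, A, hA.trans hkl, hAσ⟩

theorem MemorySuffices.mono {s₀ : S} {U k l : ℕ} (hkl : k ≤ l) (h : G.MemorySuffices s₀ U k) :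
    G.MemorySuffices s₀ U l :=
  fun i => ⟨fun c hc => ((h i).1 c hc).mono hkl, fun v t ht => ((h i).2 v t ht).mono hkl⟩

theorem card_le_size [Fintype S] : Fintype.card S ≤ G.size := Nat.le_add_right _ _

end Game

/-! ### Games in which memory is needed -/

namespace Game

section Counting

variable {S : Type} {G : Game S}

/-- A counter in which `P` holds for the first time at step `U` has at least `U + 1` states. -/
theorem succ_le_card_of_first {M : Type} [Fintype M] (g : M → M) (m : M) (P : M → Prop) {U : ℕ}
    (hlt : ∀ k < U, ¬ P (g^[k] m)) (hU : P (g^[U] m)) : U + 1 ≤ Fintype.card M := by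
  have hne : ∀ a b, a < b → b ≤ U → g^[a] m ≠ g^[b] m := by
    intro a b hab hb h
    apply hlt (U - b + a) (by omega)
    rw [Function.iterate_add_apply, h, ← Function.iterate_add_apply, Nat.sub_add_cancel hb]
    exact hU
  have hinj : Function.Injective fun k : Fin (U + 1) => g^[(k : ℕ)] m := by
    intro a b h
    by_contra hab
    rcases lt_or_gt_of_ne (fun h => hab (Fin.ext h) : (a : ℕ) ≠ b) with hlt' | hlt'
    · exact hne a b hlt' (by omega) h
    · exact hne b a hlt' (by omega) h.symm
  simpa using Fintype.card_le_of_injective _ hinj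

theorem memory_succ {i : Player} {M : Type} (A : G.MooreMachine i M) (π : G.Play) (n : ℕ) :
    memory A π (n + 1) = A.update (memory A π n) (π.1 n) := rfl

/-- With threshold `U`, the bound on the average energy is implied by the bound on the energy. -/
theorem objAELU_self (v : AEVariant) (U : ℕ) : G.objAELU v U (U : ℚ) = G.objEGLU U 0 := by
  refine Set.inter_eq_left.2 fun π hπ => ?_
  have h := avgEnergyPayoff_le (π := π) (a := U) (C := 0) (fun n => ?_) v
  · simpa [objAE] using h
  · calc ∑ m ∈ Finset.Icc 1 n, (energy π m : ℝ) ≤ ∑ m ∈ Finset.Icc 1 n, (U : ℝ) := by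
          refine Finset.sum_le_sum fun m _ => ?_
          have := (hπ m).2
          simp only [Nat.cast_zero, zero_add] at this
          exact_mod_cast this
      _ = U * n + 0 := by simp [mul_comm]

end Counting

/-- The states of the two games below; `sink` is absorbing. -/
inductive LoopState where
  | loop
  | back
  | sink
  deriving DecidableEq

open LoopState

instance : Fintype LoopState := ⟨{loop, back, sink}, fun s => by cases s <;> decide⟩

/-- The edges of the one-player game; `back` is unreachable there. -/
def oneEdges : Finset (LoopState × LoopState) :=
  {(loop, loop), (loop, sink), (back, sink), (sink, sink)}

/-- In state `loop`, player 1 can increase the energy by `1`, or decrease it by `U` and move to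
`sink`. To stay in the range `0, …, U` she has to loop exactly `U` times. -/
def oneGame (U : ℕ) : Game LoopState where
  owner _ := .one
  edges := oneEdges
  no_deadlock := by decide
  weight
    | loop, loop => 1
    | loop, sink => -U
    | _, _ => 0

/-- The edges of the two-player game. -/
def twoEdges : Finset (LoopState × LoopState) :=
  {(loop, back), (loop, sink), (back, loop), (back, sink), (sink, sink)}

/-- In state `loop`, player 2 can continue via `back`, or increase the energy by `1` and move to
`sink`, which wins only if the energy level is `U`. In state `back`, player 1 can increase the
energy by `1` and return to `loop`, or decrease it by `U` and move to `sink`, which wins only if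
the energy level is `U`. So player 2 has to continue exactly `U` times before moving to `sink`. -/
def twoGame (U : ℕ) : Game LoopState where
  owner
    | loop => .two
    | _ => .one
  edges := twoEdges
  no_deadlock := by decide
  weight
    | loop, sink => 1
    | back, loop => 1
    | back, sink => -U
    | _, _ => 0

theorem size_oneGame_le (U : ℕ) : (oneGame U).size ≤ 100 * (Nat.size U + 1) := by
  have h1 : Nat.size 1 = 1 := by decide
  have h3 : Nat.size 3 = 2 := by decide
  have hc : Fintype.card LoopState = 3 := rfl
  simp [size, oneGame, oneEdges, hc, h1, h3]
  omega

theorem size_twoGame_le (U : ℕ) : (twoGame U).size ≤ 100 * (Nat.size U + 1) := by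
  have h1 : Nat.size 1 = 1 := by decide
  have h3 : Nat.size 3 = 2 := by decide
  have hc : Fintype.card LoopState = 3 := rfl
  simp [size, twoGame, twoEdges, hc, h1, h3]
  omega

theorem eq_or_eq_of_edge_one {U : ℕ} {s : LoopState} (h : (loop, s) ∈ (oneGame U).edges) :
    s = loop ∨ s = sink := by
  revert s; change ∀ s, (loop, s) ∈ oneEdges → s = loop ∨ s = sink; decide

theorem eq_sink_of_edge_two {U : ℕ} {s : LoopState} (h : (sink, s) ∈ (twoGame U).edges) :
    s = sink := by
  revert s; change ∀ s, (sink, s) ∈ twoEdges → s = sink; decide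

theorem eq_or_eq_of_edge_two_loop {U : ℕ} {s : LoopState} (h : (loop, s) ∈ (twoGame U).edges) :
    s = back ∨ s = sink := by
  revert s; change ∀ s, (loop, s) ∈ twoEdges → s = back ∨ s = sink; decide

theorem eq_or_eq_of_edge_two_back {U : ℕ} {s : LoopState} (h : (back, s) ∈ (twoGame U).edges) :
    s = loop ∨ s = sink := by
  revert s; change ∀ s, (back, s) ∈ twoEdges → s = loop ∨ s = sink; decide

theorem wins_oneGame (U : ℕ) : (oneGame U).Wins .one loop ((oneGame U).objEGLU U 0) := by
  let σ : (oneGame U).Strategy .one :=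
    { move := fun ρ s => if s = loop ∧ ρ.length < U then loop else sink
      legal := fun ρ s _ _ => by
        change _ ∈ oneEdges
        cases s <;> by_cases h : ρ.length < U <;> simp [h, oneEdges] }
  refine ⟨σ, fun τ => ?_⟩
  set π := outcome loop σ τ with hπ
  have hmove : ∀ n, π.1 (n + 1) = if π.1 n = loop ∧ n < U then loop else sink := fun n => by
    rw [hπ, outcome_succ_of_one rfl]
    simp only [σ, length_run]
  have key : ∀ n, (n ≤ U ∧ π.1 n = loop ∧ energy π n = n) ∨ (π.1 n = sink ∧ energy π n = 0) := by
    intro n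
    induction n with
    | zero => exact Or.inl ⟨Nat.zero_le _, rfl, rfl⟩
    | succ n ih =>
      rcases ih with ⟨h1, h2, h3⟩ | ⟨h1, h2⟩
      · by_cases hn : n < U
        · have h4 : π.1 (n + 1) = loop := by rw [hmove, if_pos ⟨h2, hn⟩]
          refine Or.inl ⟨hn, h4, ?_⟩
          rw [energy_succ, h2, h3, h4]
          simp [oneGame]
        · have h4 : π.1 (n + 1) = sink := by rw [hmove, if_neg (by tauto)]
          refine Or.inr ⟨h4, ?_⟩
          rw [energy_succ, h2, h3, h4]
          simp only [oneGame]
          omega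
      · have h4 : π.1 (n + 1) = sink := by rw [hmove, if_neg (by simp [h1])]
        refine Or.inr ⟨h4, ?_⟩
        rw [energy_succ, h1, h2, h4]
        simp [oneGame]
  intro n
  rcases key n with ⟨h1, -, h2⟩ | ⟨-, h2⟩ <;> rw [h2] <;> simp; omega

/-- Before player 1 leaves `loop` for the first time, the memory evolves by iterating one map, so
the machine has to count the `U` rounds. -/
theorem le_of_winsWithMemory_oneGame {U l : ℕ}
    (h : (oneGame U).WinsWithMemory .one loop ((oneGame U).objEGLU U 0) l) : U + 1 ≤ l := by
  obtain ⟨σ, hσ, M, hM, A, hcard, hA⟩ := h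
  refine le_trans ?_ hcard
  let τ : (oneGame U).Strategy .two := ⟨fun _ s => s, fun _ _ h _ => nomatch h⟩
  have hW := hσ τ
  set π := outcome loop σ τ with hπ
  have hnext : ∀ n, π.1 n = loop → π.1 (n + 1) = A.next (memory A π n) ⟨loop, rfl⟩ := by
    intro n hn
    refine (outcome_succ_of_encodes_one hA τ n rfl).trans ?_
    congr 2
  have key : ∀ n ≤ U, π.1 n = loop ∧ energy π n = n ∧
      memory A π n = (fun m => A.update m loop)^[n] A.init := by
    intro n
    induction n with
    | zero => exact fun _ => ⟨rfl, rfl, rfl⟩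
    | succ n ih =>
      intro hn
      obtain ⟨h1, h2, h3⟩ := ih (by omega)
      have h4 : π.1 (n + 1) = loop := by
        have he := π.2 n
        rw [h1] at he
        rcases eq_or_eq_of_edge_one he with h4 | h4
        · exact h4
        · have h5 := (hW (n + 1)).1
          rw [energy_succ, h1, h2, h4] at h5
          simp only [oneGame] at h5
          omega
      refine ⟨h4, ?_, ?_⟩
      · rw [energy_succ, h1, h2, h4]
        simp [oneGame]
      · rw [Function.iterate_succ_apply', ← h3, memory_succ, h1]
  refine succ_le_card_of_first (fun m => A.update m loop) A.init
    (fun m => A.next m ⟨loop, rfl⟩ = sink) (fun k hk => ?_) ?_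
  · rw [← (key k hk.le).2.2, ← hnext k (key k hk.le).1, (key (k + 1) hk).1]
    decide
  · obtain ⟨h1, h2, h3⟩ := key U le_rfl
    rw [← h3, ← hnext U h1]
    have he := π.2 U
    rw [h1] at he
    refine (eq_or_eq_of_edge_one he).resolve_left fun h4 => ?_
    have h5 := (hW (U + 1)).2
    rw [energy_succ, h1, h2, h4] at h5
    simp only [oneGame] at h5
    omega

theorem wins_twoGame (U : ℕ) : (twoGame U).Wins .two loop ((twoGame U).objEGLU U 0) := by
  let τ : (twoGame U).Strategy .two :=
    { move := fun ρ _ => if ρ.length < 2 * U then back else sink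
      legal := fun ρ s h _ => by
        change _ ∈ twoEdges
        cases s
        · by_cases h : ρ.length < 2 * U <;> simp [h, twoEdges]
        · nomatch h
        · nomatch h }
  refine ⟨τ, fun σ hW => ?_⟩
  set π := outcome loop σ τ with hπ
  have hmove : ∀ n, π.1 n = loop → π.1 (n + 1) = if n < 2 * U then back else sink := fun n hn => by
    rw [hπ, outcome_succ_of_two (by rw [← hπ, hn]; rfl)]
    simp only [τ, length_run]
  have key : ∀ k ≤ U, π.1 (2 * k) = loop ∧ energy π (2 * k) = k := by
    intro k
    induction k with
    | zero => exact fun _ => ⟨rfl, rfl⟩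
    | succ k ih =>
      intro hk
      obtain ⟨h1, h2⟩ := ih (by omega)
      have h3 : π.1 (2 * k + 1) = back := by rw [hmove _ h1, if_pos (by omega)]
      have h4 : energy π (2 * k + 1) = k := by
        rw [energy_succ, h1, h2, h3]
        simp [twoGame]
      have he := π.2 (2 * k + 1)
      rw [h3] at he
      have h5 : π.1 (2 * (k + 1)) = loop := by
        refine (eq_or_eq_of_edge_two_back he).resolve_right fun h5 => ?_
        have h6 := (hW (2 * k + 1 + 1)).1
        rw [energy_succ, h3, h4, h5] at h6
        simp only [twoGame] at h6
        omega
      refine ⟨h5, ?_⟩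
      change energy π (2 * k + 1 + 1) = _
      rw [energy_succ, h3, h4]
      change (k : ℤ) + (twoGame U).weight back (π.1 (2 * (k + 1))) = _
      rw [h5]
      simp [twoGame]
  obtain ⟨h1, h2⟩ := key U le_rfl
  have h3 : π.1 (2 * U + 1) = sink := by rw [hmove _ h1, if_neg (by omega)]
  have h4 := (hW (2 * U + 1)).2
  rw [energy_succ, h1, h2, h3] at h4
  simp only [twoGame] at h4
  omega

/-- From one visit of `loop` to the next the memory again evolves by a fixed map. If it does not
count exactly `U` rounds, the energy stays in range against the strategy `σ` of player 1. -/
theorem le_of_winsWithMemory_twoGame {U l : ℕ}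
    (h : (twoGame U).WinsWithMemory .two loop ((twoGame U).objEGLU U 0) l) : U + 1 ≤ l := by
  obtain ⟨τ, hτ, M, hM, A, hcard, hA⟩ := h
  refine le_trans ?_ hcard
  -- `σ` lets the energy grow up to `U`, and moves to `sink` if player 2 continues at
  -- the level `U`
  let σ : (twoGame U).Strategy .one :=
    { move := fun ρ s => if s = back ∧ ρ.length < 2 * U then loop else sink
      legal := fun ρ s h _ => by
        change _ ∈ twoEdges
        cases s
        · nomatch h
        · by_cases h : ρ.length < 2 * U <;> simp [h, twoEdges]
        · simp [twoEdges] }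
  have hW := hτ σ
  set π := outcome loop σ τ with hπ
  have hmove : ∀ n, π.1 n = back → π.1 (n + 1) = if n < 2 * U then loop else sink := fun n hn => by
    rw [hπ, outcome_succ_of_one (by rw [← hπ, hn]; rfl), ← hπ, hn]
    simp [σ, length_run]
  have hnext : ∀ n, π.1 n = loop → π.1 (n + 1) = A.next (memory A π n) ⟨loop, rfl⟩ := by
    intro n hn
    refine (outcome_succ_of_encodes_two hA σ n (by rw [← hπ, hn]; rfl)).trans ?_
    congr 2
  by_contra hlt
  set g : M → M := fun m => A.update (A.update m loop) back with hg
  set P : M → Prop := fun m => A.next m ⟨loop, rfl⟩ = sink with hP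
  -- otherwise player 2 moves to `sink` before the level `U` or continues at the level `U`
  have hbad : ¬ ((∀ k < U, ¬ P (g^[k] A.init)) ∧ P (g^[U] A.init)) :=
    fun h => hlt (succ_le_card_of_first g A.init P h.1 h.2)
  apply hW
  have key : ∀ n,
      (∃ k ≤ U, n = 2 * k ∧ π.1 n = loop ∧ energy π n = k ∧ memory A π n = g^[k] A.init ∧
        ∀ j < k, ¬ P (g^[j] A.init)) ∨
      (∃ k ≤ U, n = 2 * k + 1 ∧ π.1 n = back ∧ energy π n = k ∧
        A.update (memory A π n) back = g^[k + 1] A.init ∧ ∀ j < k + 1, ¬ P (g^[j] A.init)) ∨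
      (π.1 n = sink ∧ 0 ≤ energy π n ∧ energy π n ≤ U) := by
    intro n
    induction n with
    | zero => exact Or.inl ⟨0, Nat.zero_le _, rfl, rfl, rfl, rfl, by simp⟩
    | succ n ih =>
      rcases ih with ⟨k, hk, hn, h1, h2, h3, h4⟩ | ⟨k, hk, hn, h1, h2, h3, h4⟩ | ⟨h1, h2, h3⟩
      · have hx := hnext n h1
        have he := π.2 n
        rw [h1] at he
        rcases eq_or_eq_of_edge_two_loop he with h5 | h5
        · have hnP : ¬ P (g^[k] A.init) := by
            rw [← h3]
            change ¬ A.next _ _ = sink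
            rw [← hx, h5]
            decide
          refine Or.inr (Or.inl ⟨k, hk, by omega, h5, ?_, ?_, ?_⟩)
          · rw [energy_succ, h1, h2, h5]
            simp [twoGame]
          · rw [Function.iterate_succ_apply', ← h3, memory_succ, h1]
          · intro j hj
            rcases Nat.lt_succ_iff_lt_or_eq.1 hj with hj | rfl
            · exact h4 j hj
            · exact hnP
        · have hPk : P (g^[k] A.init) := by
            rw [← h3]
            change A.next _ _ = sink
            rw [← hx, h5]
          have hkU : k ≠ U := by
            rintro rfl
            exact hbad ⟨h4, hPk⟩
          refine Or.inr (Or.inr ⟨h5, ?_⟩)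
          rw [energy_succ, h1, h2, h5]
          simp only [twoGame]
          omega
      · have hx := hmove n h1
        by_cases hkU : k < U
        · rw [if_pos (by omega)] at hx
          refine Or.inl ⟨k + 1, hkU, by omega, hx, ?_, ?_, h4⟩
          · rw [energy_succ, h1, h2, hx]
            simp [twoGame]
          · rw [memory_succ, h1, h3]
        · rw [if_neg (by omega)] at hx
          refine Or.inr (Or.inr ⟨hx, ?_⟩)
          rw [energy_succ, h1, h2, hx]
          simp only [twoGame]
          omega
      · have he := π.2 n
        rw [h1] at he
        have h5 := eq_sink_of_edge_two he
        refine Or.inr (Or.inr ⟨h5, ?_⟩)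
        have hw : (twoGame U).weight sink sink = 0 := rfl
        rw [energy_succ, h1, h5, hw]
        omega
  intro n
  rcases key n with ⟨k, hk, -, -, h2, -⟩ | ⟨k, hk, -, -, h2, -⟩ | ⟨-, h2, h3⟩ <;>
    simp only [Nat.cast_zero, zero_add] <;> omega

theorem exists_winsNeedingMemory (i : Player) (U : ℕ) :
    ∃ G : Game LoopState, G.size ≤ 100 * (Nat.size U + 1) ∧
      WinsNeedingMemory i loop (G.objEGLU U 0) (U + 1) := by
  cases i with
  | one => exact ⟨oneGame U, size_oneGame_le U, wins_oneGame U,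
      fun _ => le_of_winsWithMemory_oneGame⟩
  | two => exact ⟨twoGame U, size_twoGame_le U, wins_twoGame U,
      fun _ => le_of_winsWithMemory_twoGame⟩

end Game

theorem mainTheorem7 :
    -- pseudo-polynomial memory suffices for both players
    (∀ (S : Type) [Fintype S] (G : Game S) (s₀ : S) (U : ℕ),
      G.MemorySuffices s₀ U ((U + 1) * Fintype.card S + 1)) ∧
    -- and it is necessary, for each of the two players
    (∀ i : Player, ∃ N : ℕ, ∀ U : ℕ, ∃ (S : Type) (_ : Fintype S) (G : Game S) (s₀ : S),
      Fintype.card S ≤ N ∧ G.size ≤ N * (Nat.size U + 1) ∧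
      Game.WinsNeedingMemory i s₀ (G.objEGLU U 0) (U + 1) ∧
      ∀ v : AEVariant, Game.WinsNeedingMemory i s₀ (G.objAELU v U (U : ℚ)) (U + 1)) ∧
    -- polynomial memory suffices if the bound is polynomial in the size of the game
    (∀ p : Polynomial ℕ, ∃ q : Polynomial ℕ,
      ∀ (S : Type) [Fintype S] (G : Game S) (s₀ : S) (U : ℕ),
        U ≤ p.eval G.size → G.MemorySuffices s₀ U (q.eval G.size)) ∧
    -- or if the bound is encoded in unary
    (∃ q : Polynomial ℕ, ∀ (S : Type) [Fintype S] (G : Game S) (s₀ : S) (U : ℕ),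
      G.MemorySuffices s₀ U (q.eval (G.size + U))) := by
  refine ⟨fun S _ G s₀ U => Game.memorySuffices s₀ U, fun i => ⟨100, fun U => ?_⟩,
    fun p => ⟨(p + 1) * Polynomial.X + 1, fun S _ G s₀ U hU => ?_⟩,
    (Polynomial.X + 1) * Polynomial.X + 1, fun S _ G s₀ U => ?_⟩
  · obtain ⟨G, hsize, hG⟩ := Game.exists_winsNeedingMemory i U
    refine ⟨Game.LoopState, inferInstance, G, .loop, ?_, hsize, hG, fun v => ?_⟩
    · change 3 ≤ 100
      norm_num
    · rwa [Game.objAELU_self]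
  · refine (Game.memorySuffices s₀ U).mono ?_
    simp only [Polynomial.eval_add, Polynomial.eval_mul, Polynomial.eval_X, Polynomial.eval_one]
    gcongr
    exact Game.card_le_size
  · refine (Game.memorySuffices s₀ U).mono ?_
    simp only [Polynomial.eval_add, Polynomial.eval_mul, Polynomial.eval_X, Polynomial.eval_one]
    have := Game.card_le_size (G := G)
    gcongr <;> omega
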